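/- Let $G$ be a finite group of order $N$, let $S\subseteq G$ be closed under conjugation, and let $\Gamma=\mathrm{Cay}(G;S)$ be the (directed) Cayley graph with vertex set $G$ and an edge from $x$ to $y$ if and only if $x^{-1}y\in S$. Let $\widehat G$ be a complete set of representatives of the equivalence classes of irreducible unitary representations $\pi:G\to \mathrm{U}_{d_\pi}(\mathbb C)$, and for $\pi\in\widehat G$ and $1\le i,j\le d_\pi$ put $\phi^\pi_{i,j}=\sqrt{d_\pi/N}\,\pi_{i,j}\in\mathbb C^G$, where $\pi_{i,j}(x)$ is the $(i,j)$ entry of $\pi(x)$. Let $\Phi$ be the matrix whose columns are the $\phi^\pi_{i,j}$. For $f,h\in\mathbb C^G$ let $\widehat f=\Phi^*f$, that is, $\widehat f(\phi^\pi_{i,j})=\sum_{x\in G}f(x)\overline{\phi^\pi_{i,j}(x)}$, and let $f*h=\Phi(\widehat f\circ\widehat h)$, where $\circ$ is the entrywise product. Then the vectors $\phi^\pi_{i,j}$ form an orthonormal basis of $\mathbb C^G$ consisting of eigenvectors of the adjacency matrix of $\Gamma$, where $\phi^\pi_{i,j}$ has eigenvalue $\frac1{d_\pi}\sum_{s\in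 S}\operatorname{tr}\pi(s)$. Let $\phi_1,\dots,\phi_N$ be any enumeration of this basis. Let $g\in\mathbb C^G$ be nonzero, and assume that for every $\pi\in\widehat G$ there is a constant $\widehat g_\pi\in\mathbb C$ with $\widehat g(\phi^\pi_{i,j})=\widehat g_\pi$ for all $1\le i,j\le d_\pi$. Let the family $(A_m)$ be either 1. the $N$ translation operators $T_x$, $x\in G$, given by $T_x f=f*(\sqrt N\,\delta_x)$, where $\delta_x$ is the indicator function of $\{x\}$; or 2. the $N$ repeated shifts $A_m=A_\alpha^{m-1}$, $m=1,\dots,N$, where $A_\alpha=\Phi D_\alpha\Phi^*$, the columns of $\Phi$ being ordered as $\phi_1,\dots,\phi_N$, $D_\alpha=\operatorname{diag}(\alpha_1,\dots,\alpha_N)$, $\alpha_k=e^{i(c-2\pi(k-1)/N)}$, and $c\in[0,2\pi)$ is arbitrary. Then the $N^2$ vectors $g_{m,\ell}=\phi_\ell\circ(A_m g)$ form a tight frame for $\mathbb C^G$ with optimal frame bounds $$A=B=\sum_{\pi\in\widehat G}|\widehat g_\pi|^2d_\pi^2 .$$ That is, this common value is positive, and it is both the largest $A$ and the smallest $B$ such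 that $A\|f\|_2^2\le\sum_{m,\ell}|\langle f,g_{m,\ell}\rangle|^2\le B\|f\|_2^2$ for all $f\in\mathbb C^G$. -/

import Mathlib

namespace CayleyGabor

/-! ### Finite frames -/

section Frames

variable {H : Type*} [NormedAddCommGroup H] [InnerProductSpace ℂ H] {X : Type*} [Fintype X]

/-- The frame inequality `A ‖f‖² ≤ ∑ₓ |⟨f, vₓ⟩|²` for all `f`. -/
def IsLowerFrameBound (v : X → H) (A : ℝ) : Prop :=
  ∀ f : H, A * ‖f‖ ^ 2 ≤ ∑ x, ‖inner ℂ (v x) f‖ ^ 2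

/-- The frame inequality `∑ₓ |⟨f, vₓ⟩|² ≤ B ‖f‖²` for all `f`. -/
def IsUpperFrameBound (v : X → H) (B : ℝ) : Prop :=
  ∀ f : H, ∑ x, ‖inner ℂ (v x) f‖ ^ 2 ≤ B * ‖f‖ ^ 2

/-- A (finite) family of vectors is a frame if it admits positive lower and upper frame bounds. -/
def IsFrame (v : X → H) : Prop :=
  ∃ A B : ℝ, 0 < A ∧ 0 < B ∧ IsLowerFrameBound v A ∧ IsUpperFrameBound v B

/-- `A` is the largest lower frame bound of `v` and `B` is the smallest upper one. -/
def HasOptimalFrameBounds (v : X → H) (A B : ℝ) : Prop :=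
  IsGreatest {a : ℝ | IsLowerFrameBound v a} A ∧ IsLeast {b : ℝ | IsUpperFrameBound v b} B

/-- `v` is a tight frame, and `C` is the common value of its optimal frame bounds. -/
def IsTightFrame (v : X → H) (C : ℝ) : Prop :=
  IsFrame v ∧ HasOptimalFrameBounds v C C

end Frames

/-! ### Cayley graphs -/

/-- The (directed) Cayley graph `Cay(G; S)`: there is an edge from `x` to `y` iff `x⁻¹ y ∈ S`. -/
def cayleyGraph {G : Type*} [Group G] (S : Finset G) : Digraph G where
  Adj x y := x⁻¹ * y ∈ S

open Classical in
/-- The adjacency matrix of a directed graph. -/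
noncomputable def adjMatrix {V : Type*} (Γ : Digraph V) : Matrix V V ℂ :=
  Matrix.of fun x y => if Γ.Adj x y then 1 else 0

/-! ### Irreducible unitary representations -/

/-- The linear representation on `ℂᵈ` given by a homomorphism into the `d × d` unitary matrices. -/
noncomputable def toRep {G : Type*} [Group G] {n : ℕ}
    (σ : G →* Matrix.unitaryGroup (Fin n) ℂ) : Representation ℂ G (Fin n → ℂ) :=
  (Matrix.toLinAlgEquiv' : Matrix (Fin n) (Fin n) ℂ ≃ₐ[ℂ] _).toMonoidHom.comp
    ((Matrix.unitaryGroup (Fin n) ℂ).subtype.comp σ)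

/-- `π 0, …, π (D - 1)` is a list of all irreducible unitary representations of `G`, one from each
equivalence class. -/
structure IsUnitaryDual {G : Type*} [Group G] {D : ℕ} {d : Fin D → ℕ}
    (π : ∀ k, G →* Matrix.unitaryGroup (Fin (d k)) ℂ) : Prop where
  irreducible : ∀ k, (toRep (π k)).IsIrreducible
  inequivalent : ∀ k l, k ≠ l → ¬ Nonempty ((toRep (π k)).Equiv (toRep (π l)))
  complete : ∀ (n : ℕ) (σ : G →* Matrix.unitaryGroup (Fin n) ℂ), (toRep σ).IsIrreducible →
    ∃ k, Nonempty ((toRep σ).Equiv (toRep (π k)))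

/-! ### Fourier analysis with respect to the coordinate functions -/

/-- Indices `(k, i, j)` of the coordinate functions `π⁽ᵏ⁾ᵢⱼ`. -/
abbrev BasisIndex {D : ℕ} (d : Fin D → ℕ) : Type := (k : Fin D) × (Fin (d k) × Fin (d k))

section Fourier

variable {G : Type*} [Group G] [Fintype G] {D : ℕ} {d : Fin D → ℕ}
  (π : ∀ k, G →* Matrix.unitaryGroup (Fin (d k)) ℂ)

/-- The normalized coordinate function `φ⁽ᵏ⁾ᵢⱼ = √(dₖ / N) π⁽ᵏ⁾ᵢⱼ`, where `N = |G|`. -/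
noncomputable def phi (p : BasisIndex d) : EuclideanSpace ℂ G :=
  WithLp.toLp 2 fun x =>
    (Real.sqrt ((d p.1 : ℝ) / (Fintype.card G : ℝ)) : ℂ) *
      (π p.1 x : Matrix (Fin (d p.1)) (Fin (d p.1)) ℂ) p.2.1 p.2.2

/-- The matrix `Φ` whose columns are the vectors `φ⁽ᵏ⁾ᵢⱼ`. -/
noncomputable def Phi : Matrix G (BasisIndex d) ℂ :=
  Matrix.of fun x p => phi π p x

/-- The graph Fourier transform `f̂ = Φ* f`, that is, `f̂(φ) = ∑ₓ f(x) conj(φ(x))`. -/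
noncomputable def gft (f : EuclideanSpace ℂ G) : BasisIndex d → ℂ :=
  Matrix.mulVec (Phi π).conjTranspose fun x => f x

/-- The convolution `f * h = Φ (f̂ ∘ ĥ)`. -/
noncomputable def conv (f h : EuclideanSpace ℂ G) : EuclideanSpace ℂ G :=
  WithLp.toLp 2 (Matrix.mulVec (Phi π) fun p => gft π f p * gft π h p)

/-- The translation operators `Tₓ f = f * (√N δₓ)`. -/
noncomputable def translation [DecidableEq G] (x : G) (f : EuclideanSpace ℂ G) :
    EuclideanSpace ℂ G :=
  conv π f ((Real.sqrt (Fintype.card G : ℝ) : ℂ) • EuclideanSpace.single x 1)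

/-- The phases `α_p = exp (i (c - 2π (k - 1) / N))`, where `p` is the `k`-th index in the
enumeration `e`; since `Fin` counts from `0`, `e p` is `k - 1`. -/
noncomputable def phase (N : ℕ) (c : ℝ)
    (e : BasisIndex d ≃ Fin (Fintype.card (BasisIndex d))) (p : BasisIndex d) : ℂ :=
  Complex.exp (Complex.I * ((c - 2 * Real.pi * ((e p : ℕ) : ℝ) / (N : ℝ) : ℝ) : ℂ))

/-- The shift operator `A_α = Φ D_α Φ*`. -/
noncomputable def shiftMatrix (α : BasisIndex d → ℂ) : Matrix G G ℂ :=
  Phi π * Matrix.diagonal α * (Phi π).conjTranspose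

/-- The repeated shifts `f ↦ A_α ^ m f`, for `m = 0, …, N - 1`. -/
noncomputable def repeatedShift [DecidableEq G] (α : BasisIndex d → ℂ)
    (m : Fin (Fintype.card G)) (f : EuclideanSpace ℂ G) : EuclideanSpace ℂ G :=
  WithLp.toLp 2 (Matrix.mulVec (shiftMatrix π α ^ (m : ℕ)) fun x => f x)

/-- The Gabor-type family `g_{m,ℓ} = φ_ℓ ∘ (A_m g)` (entrywise product). -/
noncomputable def gaborFamily {M : Type*}
    (A : M → EuclideanSpace ℂ G → EuclideanSpace ℂ G) (g : EuclideanSpace ℂ G) :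
    M × BasisIndex d → EuclideanSpace ℂ G :=
  fun q => WithLp.toLp 2 fun x => phi π q.2 x * A q.1 g x

end Fourier

end CayleyGabor

open CayleyGabor

namespace CayleyGabor

open Matrix

/-! ### Schur's lemma and the orthogonality relations. -/

section Schur

variable {G : Type*} [Group G]

/-! For fixed `m`, the inner products of `f` with `φ_ℓ ∘ A_m g` are the coefficients of `conj(A_m g)
· f` in the basis `φ`. Parseval turns the frame sum into `∑ₓ |f x|² ∑ₘ |A_m g x|²`
(`sum_norm_sq_inner_gaborFamily`), so it suffices that the inner sum does not depend on `x`.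

Both operator families act by `A_m g = ∑ₚ u m p · ĝ p · φ p`, where the columns of `u` are
orthogonal with squared norm `N`. By `sum_norm_sq_of_orthogonal` the inner sum is `N ∑ₚ |ĝ p|² |φ p
x|²`. As `ĝ` is constant on each block and `π k x` is unitary, block `k` contributes `|ĝ k|² d k²`
for every `x` (`card_mul_sum_norm_sq`). For translations the columns are orthogonal because the `φ`
are; for repeated shifts, because geometric sums of nontrivial `N`-th roots of unity vanish.

The basis itself is Peter–Weyl for a finite group: Schur's lemma gives `orthonormal_phi`, and a
minimal invariant subspace of the orthogonal complement would give a representation missing from the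
list (`span_phi_eq_top`). The eigenvalues come from `∑ s ∈ S, π s`, which is scalar by Schur. -/

lemma toRep_apply {n : ℕ} (σ : G →* Matrix.unitaryGroup (Fin n) ℂ) (x : G) (v : Fin n → ℂ) :
    toRep σ x v = (σ x : Matrix (Fin n) (Fin n) ℂ) *ᵥ v := rfl

/-- A matrix intertwining two unitary representations, as an intertwining map. -/
noncomputable def intertwiner {m n : ℕ} {σ : G →* Matrix.unitaryGroup (Fin m) ℂ}
    {τ : G →* Matrix.unitaryGroup (Fin n) ℂ} (A : Matrix (Fin m) (Fin n) ℂ)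
    (hA : ∀ x, (σ x : Matrix (Fin m) (Fin m) ℂ) * A = A * (τ x : Matrix (Fin n) (Fin n) ℂ)) :
    Representation.IntertwiningMap (toRep τ) (toRep σ) :=
  LinearMap.intertwiningMap_of_isIntertwiningMap _ _ (Matrix.toLin' A) fun x v => by
    simp only [toRep_apply, Matrix.toLin'_apply, Matrix.mulVec_mulVec, hA]

lemma intertwiner_apply {m n : ℕ} {σ : G →* Matrix.unitaryGroup (Fin m) ℂ}
    {τ : G →* Matrix.unitaryGroup (Fin n) ℂ} (A : Matrix (Fin m) (Fin n) ℂ)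
    (hA : ∀ x, (σ x : Matrix (Fin m) (Fin m) ℂ) * A = A * (τ x : Matrix (Fin n) (Fin n) ℂ))
    (v : Fin n → ℂ) : intertwiner A hA v = A *ᵥ v := rfl

/-- Schur's lemma for inequivalent irreducible unitary representations. -/
lemma eq_zero_of_intertwines {m n : ℕ} {σ : G →* Matrix.unitaryGroup (Fin m) ℂ}
    {τ : G →* Matrix.unitaryGroup (Fin n) ℂ} (hσ : (toRep σ).IsIrreducible)
    (hτ : (toRep τ).IsIrreducible) (h : ¬ Nonempty ((toRep τ).Equiv (toRep σ)))
    (A : Matrix (Fin m) (Fin n) ℂ)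
    (hA : ∀ x, (σ x : Matrix (Fin m) (Fin m) ℂ) * A = A * (τ x : Matrix (Fin n) (Fin n) ℂ)) :
    A = 0 := by
  rcases Representation.IsIrreducible.bijective_or_eq_zero (intertwiner A hA) with hb | h0
  · exact absurd ⟨(intertwiner A hA).ofBijective hb⟩ h
  · refine Matrix.ext_of_mulVec_single fun i => ?_
    rw [← intertwiner_apply A hA, h0, Matrix.zero_mulVec]
    rfl

/-- Schur's lemma: matrices commuting with an irreducible representation are scalar. -/
lemma eq_smul_one_of_commutes {n : ℕ} {σ : G →* Matrix.unitaryGroup (Fin n) ℂ}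
    (hσ : (toRep σ).IsIrreducible) (A : Matrix (Fin n) (Fin n) ℂ)
    (hA : ∀ x, (σ x : Matrix (Fin n) (Fin n) ℂ) * A = A * (σ x : Matrix (Fin n) (Fin n) ℂ)) :
    ∃ c : ℂ, A = c • 1 := by
  obtain ⟨c, hc⟩ := (Representation.IsIrreducible.algebraMap_intertwiningMap_bijective_of_isAlgClosed
    (ρ := toRep σ)).2 (intertwiner A hA)
  refine ⟨c, Matrix.ext_of_mulVec_single fun i => ?_⟩
  rw [← intertwiner_apply A hA, ← hc]
  rw [Matrix.smul_mulVec, Matrix.one_mulVec]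
  rfl

lemma dim_pos_of_irreducible {n : ℕ} {σ : G →* Matrix.unitaryGroup (Fin n) ℂ}
    (hσ : (toRep σ).IsIrreducible) : 0 < n := by
  rcases Nat.eq_zero_or_pos n with rfl | h
  · exfalso
    -- In dimension zero there is only one subspace, while irreducibility demands two distinct ones.
    obtain ⟨U, V, hUV⟩ := hσ.toNontrivial
    refine hUV (Subrepresentation.toSubmodule_injective (Subsingleton.elim _ _))
  · exact h

lemma smul_one_eq_trace_div {n : ℕ} (hn : 0 < n) {A : Matrix (Fin n) (Fin n) ℂ}
    (hA : ∃ c : ℂ, A = c • 1) : A = ((1 / (n : ℂ)) * A.trace) • 1 := by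
  obtain ⟨c, rfl⟩ := hA
  have : (n : ℂ) ≠ 0 := by exact_mod_cast hn.ne'
  congr 1
  simp
  field_simp

variable [Fintype G]

/-- Substituting `x ↦ x * y` turns `σ(x)ᴴ` into `σ(y)ᴴ σ(x)ᴴ`, whose first factor cancels against
`σ(y)`, and leaves `τ(y)` on the right. -/
lemma average_intertwines {m n : ℕ} (σ : G →* Matrix.unitaryGroup (Fin m) ℂ)
    (τ : G →* Matrix.unitaryGroup (Fin n) ℂ) (E : Matrix (Fin m) (Fin n) ℂ) (y : G) :
    (σ y : Matrix (Fin m) (Fin m) ℂ) *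
        (∑ x, (σ x : Matrix (Fin m) (Fin m) ℂ)ᴴ * E * (τ x : Matrix (Fin n) (Fin n) ℂ)) =
      (∑ x, (σ x : Matrix (Fin m) (Fin m) ℂ)ᴴ * E * (τ x : Matrix (Fin n) (Fin n) ℂ)) *
        (τ y : Matrix (Fin n) (Fin n) ℂ) := by
  have hshift := Equiv.sum_comp (Equiv.mulRight y) fun x =>
    (σ x : Matrix (Fin m) (Fin m) ℂ)ᴴ * E * (τ x : Matrix (Fin n) (Fin n) ℂ)
  conv_lhs => rw [← hshift]
  rw [Matrix.mul_sum, Matrix.sum_mul]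
  refine Finset.sum_congr rfl fun x _ => ?_
  have h : (σ y : Matrix (Fin m) (Fin m) ℂ) * (σ y : Matrix (Fin m) (Fin m) ℂ)ᴴ = 1 :=
    Unitary.coe_mul_star_self (σ y)
  simp only [Equiv.coe_mulRight, map_mul, Submonoid.coe_mul, Matrix.conjTranspose_mul]
  simp only [← Matrix.mul_assoc]
  rw [h, Matrix.one_mul]

/-- Averaging a matrix unit produces exactly the inner products of coordinate functions, so Schur's
lemma can evaluate them. -/
lemma average_single_apply {m n : ℕ} (σ : G →* Matrix.unitaryGroup (Fin m) ℂ)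
    (τ : G →* Matrix.unitaryGroup (Fin n) ℂ) (i j : Fin m) (k l : Fin n) :
    (∑ x, (σ x : Matrix (Fin m) (Fin m) ℂ)ᴴ * Matrix.single i k (1 : ℂ) *
        (τ x : Matrix (Fin n) (Fin n) ℂ) : Matrix (Fin m) (Fin n) ℂ) j l =
      ∑ x, star ((σ x : Matrix (Fin m) (Fin m) ℂ) i j) *
        (τ x : Matrix (Fin n) (Fin n) ℂ) k l := by
  rw [Matrix.sum_apply]
  refine Finset.sum_congr rfl fun x _ => ?_
  simp [Matrix.mul_apply, Matrix.single_apply, Finset.sum_ite_eq, ite_and]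

lemma sum_star_mul_eq_zero {m n : ℕ} {σ : G →* Matrix.unitaryGroup (Fin m) ℂ}
    {τ : G →* Matrix.unitaryGroup (Fin n) ℂ} (hσ : (toRep σ).IsIrreducible)
    (hτ : (toRep τ).IsIrreducible) (h : ¬ Nonempty ((toRep τ).Equiv (toRep σ)))
    (i j : Fin m) (k l : Fin n) :
    ∑ x, star ((σ x : Matrix (Fin m) (Fin m) ℂ) i j) *
        (τ x : Matrix (Fin n) (Fin n) ℂ) k l = 0 := by
  rw [← average_single_apply, eq_zero_of_intertwines hσ hτ h _ (average_intertwines σ τ _)]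
  rfl

/-- The average is scalar, hence determined by its trace; each summand is a unitary conjugate of the
matrix unit and has trace `1` or `0`. -/
lemma sum_star_mul_self {n : ℕ} {σ : G →* Matrix.unitaryGroup (Fin n) ℂ}
    (hσ : (toRep σ).IsIrreducible) (i j k l : Fin n) :
    ∑ x, star ((σ x : Matrix (Fin n) (Fin n) ℂ) i j) * (σ x : Matrix (Fin n) (Fin n) ℂ) k l =
      if i = k ∧ j = l then (Fintype.card G : ℂ) / n else 0 := by
  rw [← average_single_apply, smul_one_eq_trace_div (dim_pos_of_irreducible hσ)
    (eq_smul_one_of_commutes hσ _ (average_intertwines σ σ _)), Matrix.trace_sum]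
  have h (x : G) : Matrix.trace ((σ x : Matrix (Fin n) (Fin n) ℂ)ᴴ * Matrix.single i k 1 *
      (σ x : Matrix (Fin n) (Fin n) ℂ)) = if i = k then 1 else 0 := by
    rw [Matrix.trace_mul_comm, ← Matrix.mul_assoc,
      show (σ x : Matrix (Fin n) (Fin n) ℂ) * (σ x : Matrix (Fin n) (Fin n) ℂ)ᴴ = 1 from
        Unitary.coe_mul_star_self (σ x), Matrix.one_mul]
    split_ifs with hik
    · subst hik; simp
    · exact Matrix.trace_single_eq_of_ne _ _ _ hik
  simp only [h, Matrix.smul_apply, Matrix.one_apply, Finset.sum_const, Finset.card_univ]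
  by_cases hik : i = k <;> by_cases hjl : j = l <;> simp [hik, hjl]
  ring

end Schur

/-! ### Completeness of the coordinate functions via the right regular representation. -/

section Completeness

variable {G : Type*} [Group G]

/-- The unitary matrices of a unitary representation in an orthonormal basis. -/
noncomputable def unitaryMatrices {H : Type*} [NormedAddCommGroup H] [InnerProductSpace ℂ H]
    [FiniteDimensional ℂ H] (ρ : Representation ℂ G H)
    (hρ : ∀ x v w, inner ℂ (ρ x v) (ρ x w) = inner ℂ v w) {n : ℕ}
    (b : OrthonormalBasis (Fin n) ℂ H) : G →* Matrix.unitaryGroup (Fin n) ℂ :=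
  MonoidHom.codRestrict
    ((LinearMap.toMatrixOrthonormal b).toRingEquiv.toMonoidHom.comp ρ) _ fun x => by
      rw [Matrix.mem_unitaryGroup_iff']
      change star (LinearMap.toMatrixOrthonormal b (ρ x)) *
        LinearMap.toMatrixOrthonormal b (ρ x) = 1
      rw [← map_star, ← map_mul, ← map_one (LinearMap.toMatrixOrthonormal b)]
      congr 1
      refine LinearMap.ext fun v => ext_inner_left ℂ fun w => ?_
      rw [Module.End.mul_apply, LinearMap.star_eq_adjoint, LinearMap.adjoint_inner_right, hρ]
      rfl

lemma toRep_unitaryMatrices {H : Type*} [NormedAddCommGroup H] [InnerProductSpace ℂ H]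
    [FiniteDimensional ℂ H] (ρ : Representation ℂ G H)
    (hρ : ∀ x v w, inner ℂ (ρ x v) (ρ x w) = inner ℂ v w) {n : ℕ}
    (b : OrthonormalBasis (Fin n) ℂ H) (x : G) (v : H) :
    toRep (unitaryMatrices ρ hρ b) x (b.toBasis.equivFun v) = b.toBasis.equivFun (ρ x v) :=
  LinearMap.toMatrix_mulVec_repr b.toBasis b.toBasis (ρ x) v

/-- The matrices of an irreducible representation form an irreducible representation. -/
lemma unitaryMatrices_irreducible {H : Type*} [NormedAddCommGroup H] [InnerProductSpace ℂ H]
    [FiniteDimensional ℂ H] [Nontrivial H] (ρ : Representation ℂ G H)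
    (hρ : ∀ x v w, inner ℂ (ρ x v) (ρ x w) = inner ℂ v w) {n : ℕ}
    (b : OrthonormalBasis (Fin n) ℂ H)
    (hirr : ∀ U : Submodule ℂ H, (∀ x, ∀ v ∈ U, ρ x v ∈ U) → U = ⊥ ∨ U = ⊤) :
    (toRep (unitaryMatrices ρ hρ b)).IsIrreducible := by
  set e := b.toBasis.equivFun with he
  have : Nontrivial (Fin n → ℂ) := e.symm.toEquiv.nontrivial
  have hne : (⊥ : Subrepresentation (toRep (unitaryMatrices ρ hρ b))) ≠ ⊤ := fun h =>
    bot_ne_top (α := Submodule ℂ (Fin n → ℂ)) (congrArg Subrepresentation.toSubmodule h)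
  refine { exists_pair_ne := ⟨_, _, hne⟩, eq_bot_or_eq_top := fun U => ?_ }
  -- The coordinate isomorphism pulls invariant subspaces of `ℂⁿ` back to invariant subspaces of
  -- `H`.
  have hcases := hirr (U.toSubmodule.comap e.toLinearMap) fun x v hv => by
    have := U.apply_mem_toSubmodule x (v := e v) hv
    rwa [he, toRep_unitaryMatrices] at this
  refine hcases.imp (fun h => ?_) fun h => ?_ <;>
    refine Subrepresentation.toSubmodule_injective ?_
  · refine (Submodule.eq_bot_iff _).2 fun w hw => ?_
    have : e.symm w ∈ U.toSubmodule.comap e.toLinearMap := by simpa using hw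
    rw [h, Submodule.mem_bot] at this
    simpa using this
  · refine Submodule.eq_top_iff'.2 fun w => ?_
    have : e.symm w ∈ U.toSubmodule.comap e.toLinearMap := h ▸ Submodule.mem_top
    simpa using this

variable (G) in
/-- The right regular representation `(ρ y f)(x) = f (x y)`. -/
noncomputable def rightRegular : Representation ℂ G (EuclideanSpace ℂ G) where
  toFun y :=
    { toFun := fun f => WithLp.toLp 2 fun x => f (x * y)
      map_add' := fun _ _ => rfl
      map_smul' := fun _ _ => rfl }
  map_one' := by ext f x; simp
  map_mul' y z := by
    ext f x
    change f (x * (y * z)) = f (x * y * z)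
    rw [mul_assoc]

lemma rightRegular_apply (y x : G) (f : EuclideanSpace ℂ G) :
    rightRegular G y f x = f (x * y) := rfl

variable [Fintype G]

lemma inner_rightRegular (y : G) (f h : EuclideanSpace ℂ G) :
    inner ℂ (rightRegular G y f) (rightRegular G y h) = inner ℂ f h := by
  simp only [PiLp.inner_apply, rightRegular_apply]
  exact Equiv.sum_comp (Equiv.mulRight y) fun x => inner ℂ (f x) (h x)

variable {D : ℕ} {d : Fin D → ℕ} {π : ∀ k, G →* Matrix.unitaryGroup (Fin (d k)) ℂ}

lemma phi_apply (p : BasisIndex d) (x : G) :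
    phi π p x = (Real.sqrt ((d p.1 : ℝ) / (Fintype.card G : ℝ)) : ℂ) *
      (π p.1 x : Matrix (Fin (d p.1)) (Fin (d p.1)) ℂ) p.2.1 p.2.2 := rfl

lemma sqrt_dim_div_card_ne_zero (k : Fin D) (hk : 0 < d k) :
    (Real.sqrt ((d k : ℝ) / (Fintype.card G : ℝ)) : ℂ) ≠ 0 := by
  have : (0 : ℝ) < Fintype.card G := by exact_mod_cast Fintype.card_pos
  have : (0 : ℝ) < d k := by exact_mod_cast hk
  exact_mod_cast (Real.sqrt_pos.2 (by positivity)).ne'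

lemma mem_span_phi_of_eq_sum (k : Fin D) (hk : 0 < d k) (c : Fin (d k) → Fin (d k) → ℂ)
    (f : EuclideanSpace ℂ G)
    (hf : ∀ x, f x = ∑ i, ∑ j, c i j * (π k x : Matrix (Fin (d k)) (Fin (d k)) ℂ) i j) :
    f ∈ Submodule.span ℂ (Set.range (phi π)) := by
  have h0 := sqrt_dim_div_card_ne_zero (G := G) k hk
  have : f = ∑ i, ∑ j, (c i j * (Real.sqrt ((d k : ℝ) / (Fintype.card G : ℝ)) : ℂ)⁻¹) •
      phi π ⟨k, i, j⟩ := by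
    ext x
    simp only [hf, WithLp.ofLp_sum, Finset.sum_apply, WithLp.ofLp_smul, Pi.smul_apply, phi_apply,
      smul_eq_mul]
    refine Finset.sum_congr rfl fun i _ => Finset.sum_congr rfl fun j _ => ?_
    field_simp
  rw [this]
  exact Submodule.sum_mem _ fun i _ => Submodule.sum_mem _ fun j _ =>
    Submodule.smul_mem _ _ (Submodule.subset_span ⟨_, rfl⟩)

/-- Matrix coefficients of the `k`-th representation lie in the span of the `phi`. -/
lemma mem_span_phi_of_coefficient (k : Fin D) (hk : 0 < d k) (L : (Fin (d k) → ℂ) →ₗ[ℂ] ℂ)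
    (w : Fin (d k) → ℂ) (f : EuclideanSpace ℂ G) (hf : ∀ x, f x = L (toRep (π k) x w)) :
    f ∈ Submodule.span ℂ (Set.range (phi π)) := by
  refine mem_span_phi_of_eq_sum k hk (fun i j => L (Pi.single i 1) * w j) f fun x => ?_
  rw [hf, LinearMap.pi_apply_eq_sum_univ L]
  refine Finset.sum_congr rfl fun i _ => ?_
  have hsingle : (fun j => if i = j then (1 : ℂ) else 0) = Pi.single i 1 := by
    ext j; simp [Pi.single_apply, eq_comm]
  rw [hsingle, toRep_apply, Matrix.mulVec, dotProduct, smul_eq_mul, Finset.sum_mul]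
  exact Finset.sum_congr rfl fun j _ => by ring

/-- Right translation by `y` only replaces the vector of a matrix coefficient by its image under `π
k y`. -/
lemma rightRegular_mem_span_phi (hd : ∀ k, 0 < d k) (y : G) {f : EuclideanSpace ℂ G}
    (hf : f ∈ Submodule.span ℂ (Set.range (phi π))) :
    rightRegular G y f ∈ Submodule.span ℂ (Set.range (phi π)) := by
  induction hf using Submodule.span_induction with
  | mem f hf =>
    obtain ⟨⟨k, i, j⟩, rfl⟩ := hf
    refine mem_span_phi_of_coefficient k (hd k)
      ((Real.sqrt ((d k : ℝ) / (Fintype.card G : ℝ)) : ℂ) • LinearMap.proj i)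
      (toRep (π k) y (Pi.single j 1)) _ fun x => ?_
    rw [← Module.End.mul_apply, ← map_mul, rightRegular_apply, phi_apply, toRep_apply]
    simp
  | zero => simp
  | add f g _ _ hf hg => rw [map_add]; exact Submodule.add_mem _ hf hg
  | smul c f _ hf => rw [map_smul]; exact Submodule.smul_mem _ _ hf

/-- The image of an irreducible unitary representation in the right regular representation lies in
the span of the coordinate functions. -/
lemma mem_span_phi_of_irreducible (hπ : IsUnitaryDual π) {H : Type*} [NormedAddCommGroup H]
    [InnerProductSpace ℂ H] [FiniteDimensional ℂ H] [Nontrivial H] (ρ : Representation ℂ G H)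
    (hρ : ∀ x v w, inner ℂ (ρ x v) (ρ x w) = inner ℂ v w)
    (hirr : ∀ U : Submodule ℂ H, (∀ x, ∀ v ∈ U, ρ x v ∈ U) → U = ⊥ ∨ U = ⊤)
    (ι : H →ₗ[ℂ] EuclideanSpace ℂ G) (hι : ∀ x v, ι (ρ x v) = rightRegular G x (ι v)) (v : H) :
    ι v ∈ Submodule.span ℂ (Set.range (phi π)) := by
  let b := stdOrthonormalBasis ℂ H
  obtain ⟨k, ⟨φ⟩⟩ := hπ.complete _ _ (unitaryMatrices_irreducible ρ hρ b hirr)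
  -- Since `f x = (ρ x f) 1`, evaluation at `1` exhibits every vector in the image as a matrix
  -- coefficient.
  refine mem_span_phi_of_coefficient k (dim_pos_of_irreducible (hπ.irreducible k))
    ((EuclideanSpace.proj (1 : G)).toLinearMap ∘ₗ ι ∘ₗ b.toBasis.equivFun.symm.toLinearMap ∘ₗ
      φ.symm.toLinearEquiv.toLinearMap) (φ (b.toBasis.equivFun v)) _ fun x => ?_
  have h1 : toRep (π k) x (φ (b.toBasis.equivFun v)) = φ (b.toBasis.equivFun (ρ x v)) := by
    rw [← toRep_unitaryMatrices ρ hρ b]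
    exact (φ.toIntertwiningMap.isIntertwining _ _ x _).symm
  rw [h1]
  change ι v x = ι (b.toBasis.equivFun.symm (φ.symm (φ (b.toBasis.equivFun (ρ x v))))) 1
  rw [Representation.Equiv.symm_apply_apply, LinearEquiv.symm_apply_apply, hι,
    rightRegular_apply, one_mul]

/-- The restriction of the right regular representation along an isometry with invariant range. -/
noncomputable def pullbackRightRegular {H : Type*} [NormedAddCommGroup H] [InnerProductSpace ℂ H]
    (ι : H →ₗᵢ[ℂ] EuclideanSpace ℂ G) (hι : ∀ x v, rightRegular G x (ι v) ∈ ι.range) :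
    Representation ℂ G H where
  toFun x := (LinearEquiv.ofInjective ι.toLinearMap ι.injective).symm.toLinearMap ∘ₗ
    LinearMap.codRestrict ι.range (rightRegular G x ∘ₗ ι.toLinearMap) (hι x)
  map_one' := by
    ext v
    simp only [map_one]
    exact LinearEquiv.symm_apply_apply _ v
  map_mul' x y := by
    ext v
    refine (LinearEquiv.ofInjective ι.toLinearMap ι.injective).injective (Subtype.ext ?_)
    simp only [LinearMap.comp_apply, LinearEquiv.coe_coe, LinearEquiv.apply_symm_apply,
      Module.End.mul_apply, map_mul, LinearMap.codRestrict_apply]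
    congr 1
    exact (congrArg Subtype.val (LinearEquiv.apply_symm_apply
      (LinearEquiv.ofInjective ι.toLinearMap ι.injective)
      ⟨rightRegular G y (ι v), hι y v⟩)).symm

lemma apply_pullbackRightRegular {H : Type*} [NormedAddCommGroup H] [InnerProductSpace ℂ H]
    (ι : H →ₗᵢ[ℂ] EuclideanSpace ℂ G) (hι : ∀ x v, rightRegular G x (ι v) ∈ ι.range) (x : G)
    (v : H) : ι (pullbackRightRegular ι hι x v) = rightRegular G x (ι v) :=
  congrArg Subtype.val (LinearEquiv.apply_symm_apply
    (LinearEquiv.ofInjective ι.toLinearMap ι.injective) ⟨rightRegular G x (ι v), hι x v⟩)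

/-- An invariant subspace of `H` maps to an invariant subspace of the range, so minimality makes the
pulled-back action irreducible; the isometry keeps it unitary. -/
lemma range_le_span_phi_of_minimal (hπ : IsUnitaryDual π) {H : Type*} [NormedAddCommGroup H]
    [InnerProductSpace ℂ H] [FiniteDimensional ℂ H] [Nontrivial H]
    (ι : H →ₗᵢ[ℂ] EuclideanSpace ℂ G) (hι : ∀ x v, rightRegular G x (ι v) ∈ ι.range)
    (hmin : ∀ V ≤ ι.range, (∀ y, ∀ f ∈ V, rightRegular G y f ∈ V) → V = ⊥ ∨ V = ι.range) (v : H) :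
    ι v ∈ Submodule.span ℂ (Set.range (phi π)) := by
  have hρ := apply_pullbackRightRegular ι hι
  have hinj : Function.Injective ι.toLinearMap := ι.injective
  refine mem_span_phi_of_irreducible hπ (pullbackRightRegular ι hι)
    (fun x v w => ?_) (fun V hV => ?_) ι.toLinearMap hρ v
  · rw [← ι.inner_map_map, hρ, hρ, inner_rightRegular, ι.inner_map_map]
  refine (hmin (V.map ι.toLinearMap) LinearMap.map_le_range ?_).imp (fun h => ?_) fun h => ?_
  · rintro y _ ⟨f, hf, rfl⟩
    exact ⟨_, hV y f hf, hρ y f⟩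
  · refine Submodule.map_injective_of_injective hinj ?_
    rw [h, Submodule.map_bot]
  · refine Submodule.map_injective_of_injective hinj ?_
    rw [h, Submodule.map_top]

/-- A minimal nonzero invariant subspace of the right regular representation lies in the span of
the coordinate functions. -/
lemma le_span_phi_of_minimal (hπ : IsUnitaryDual π) (U : Submodule ℂ (EuclideanSpace ℂ G))
    (hU0 : U ≠ ⊥) (hU : ∀ y, ∀ f ∈ U, rightRegular G y f ∈ U)
    (hmin : ∀ V ≤ U, (∀ y, ∀ f ∈ V, rightRegular G y f ∈ V) → V = ⊥ ∨ V = U) :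
    U ≤ Submodule.span ℂ (Set.range (phi π)) := by
  have : Nontrivial U := Submodule.nontrivial_iff_ne_bot.2 hU0
  have hrange : U.subtypeₗᵢ.range = U := U.range_subtype
  intro f hf
  have hι : ∀ x v, rightRegular G x (U.subtypeₗᵢ v) ∈ U.subtypeₗᵢ.range := fun x v =>
    hrange.symm ▸ hU x v v.2
  have key := range_le_span_phi_of_minimal (H := U) hπ U.subtypeₗᵢ hι (by rwa [hrange])
  exact key ⟨f, hf⟩

lemma exists_minimal_invariant (W : Submodule ℂ (EuclideanSpace ℂ G)) (hW0 : W ≠ ⊥)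
    (hW : ∀ y, ∀ f ∈ W, rightRegular G y f ∈ W) :
    ∃ U ≤ W, U ≠ ⊥ ∧ (∀ y, ∀ f ∈ U, rightRegular G y f ∈ U) ∧
      ∀ V ≤ U, (∀ y, ∀ f ∈ V, rightRegular G y f ∈ V) → V = ⊥ ∨ V = U := by
  obtain ⟨U, ⟨hUW, hU0, hU⟩, hmin⟩ := WellFounded.has_min
    (wellFounded_lt (α := Submodule ℂ (EuclideanSpace ℂ G)))
    {U | U ≤ W ∧ U ≠ ⊥ ∧ ∀ y, ∀ f ∈ U, rightRegular G y f ∈ U} ⟨W, le_rfl, hW0, hW⟩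
  refine ⟨U, hUW, hU0, hU, fun V hVU hV => ?_⟩
  by_contra! hne
  exact hmin V ⟨hVU.trans hUW, hne.1, hV⟩ (lt_of_le_of_ne hVU hne.2)

/-- The coordinate functions span `ℂ^G`. -/
lemma span_phi_eq_top (hπ : IsUnitaryDual π) :
    Submodule.span ℂ (Set.range (phi π)) = ⊤ := by
  have hd k := dim_pos_of_irreducible (hπ.irreducible k)
  rw [← Submodule.orthogonal_eq_bot_iff]
  by_contra hne
  obtain ⟨U, hUW, hU0, hU, hmin⟩ := exists_minimal_invariant _ hne fun y f hf => by
    rw [Submodule.mem_orthogonal] at hf ⊢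
    intro h hh
    -- Unitarity moves the translation to the other argument, so the complement of the invariant
    -- span is invariant.
    rw [← hf _ (rightRegular_mem_span_phi hd y⁻¹ hh), ← inner_rightRegular y⁻¹,
      ← Module.End.mul_apply _ _ f, ← map_mul]
    simp
  refine hU0 ((Submodule.eq_bot_iff _).2 fun f hf => ?_)
  -- `f` lies both in the span and in its orthogonal complement.
  exact inner_self_eq_zero.1
    ((Submodule.mem_orthogonal _ _).1 (hUW hf) f (le_span_phi_of_minimal hπ U hU0 hU hmin hf))

/-! ### The orthonormal basis and its eigenvalues. -/

lemma inner_phi (p q : BasisIndex d) :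
    inner ℂ (phi π p) (phi π q) =
      (Real.sqrt ((d p.1 : ℝ) / (Fintype.card G : ℝ)) : ℂ) *
        (Real.sqrt ((d q.1 : ℝ) / (Fintype.card G : ℝ)) : ℂ) *
        ∑ x, star ((π p.1 x : Matrix (Fin (d p.1)) (Fin (d p.1)) ℂ) p.2.1 p.2.2) *
          (π q.1 x : Matrix (Fin (d q.1)) (Fin (d q.1)) ℂ) q.2.1 q.2.2 := by
  rw [PiLp.inner_apply, Finset.mul_sum]
  refine Finset.sum_congr rfl fun x _ => ?_
  rw [phi_apply, phi_apply, RCLike.inner_apply, map_mul, Complex.conj_ofReal, starRingEnd_apply]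
  ring

lemma orthonormal_phi (hπ : IsUnitaryDual π) : Orthonormal ℂ (phi π) := by
  rw [orthonormal_iff_ite]
  rintro ⟨k, i, j⟩ ⟨l, i', j'⟩
  rw [inner_phi]
  by_cases hkl : k = l
  · subst hkl
    have hd : (d k : ℂ) ≠ 0 := by
      exact_mod_cast (dim_pos_of_irreducible (hπ.irreducible k)).ne'
    have hN : (Fintype.card G : ℂ) ≠ 0 := by exact_mod_cast Fintype.card_ne_zero
    rw [sum_star_mul_self (hπ.irreducible k), ← Complex.ofReal_mul,
      Real.mul_self_sqrt (by positivity)]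
    by_cases h : i = i' ∧ j = j'
    · obtain ⟨rfl, rfl⟩ := h
      simp
      field_simp
    · rw [if_neg h, mul_zero, if_neg]
      simpa using h
  · rw [sum_star_mul_eq_zero (hπ.irreducible k) (hπ.irreducible l)
      (hπ.inequivalent l k (Ne.symm hkl)), mul_zero, if_neg]
    exact fun h => hkl (congrArg Sigma.fst h)

/-- The coordinate functions as an orthonormal basis. -/
noncomputable def phiBasis (hπ : IsUnitaryDual π) :
    OrthonormalBasis (BasisIndex d) ℂ (EuclideanSpace ℂ G) :=
  OrthonormalBasis.mk (orthonormal_phi hπ) (span_phi_eq_top hπ).ge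

lemma phiBasis_apply (hπ : IsUnitaryDual π) (p : BasisIndex d) : phiBasis hπ p = phi π p := by
  rw [phiBasis, OrthonormalBasis.coe_mk]

/-- The coordinate functions are eigenvectors of the Cayley graph of a conjugation invariant set. -/
lemma adjMatrix_cayleyGraph_phi [DecidableEq G] (hπ : IsUnitaryDual π) (S : Finset G)
    (hS : ∀ x : G, ∀ s ∈ S, x * s * x⁻¹ ∈ S) (p : BasisIndex d) :
    (Matrix.toEuclideanLin (adjMatrix (cayleyGraph S))) (phi π p) =
      ((1 / (d p.1 : ℂ)) *
        ∑ s ∈ S, Matrix.trace (π p.1 s : Matrix (Fin (d p.1)) (Fin (d p.1)) ℂ)) • phi π p := by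
  obtain ⟨k, i, j⟩ := p
  have hcomm (y : G) : (π k y : Matrix (Fin (d k)) (Fin (d k)) ℂ) *
      (∑ s ∈ S, (π k s : Matrix (Fin (d k)) (Fin (d k)) ℂ)) =
      (∑ s ∈ S, (π k s : Matrix (Fin (d k)) (Fin (d k)) ℂ)) *
        (π k y : Matrix (Fin (d k)) (Fin (d k)) ℂ) := by
    rw [Finset.mul_sum, Finset.sum_mul]
    -- Conjugation by `y` permutes `S`, so the sum over `S` commutes with the representation.
    refine Finset.sum_bij' (fun s _ => y * s * y⁻¹) (fun s _ => y⁻¹ * s * y) (hS y)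
      (fun s hs => by simpa using hS y⁻¹ s hs) (fun s _ => by group) (fun s _ => by group)
      fun s _ => ?_
    rw [← Submonoid.coe_mul, ← Submonoid.coe_mul, ← map_mul, ← map_mul]
    congr 2
    group
  have hscalar := smul_one_eq_trace_div (dim_pos_of_irreducible (hπ.irreducible k))
    (eq_smul_one_of_commutes (hπ.irreducible k) _ hcomm)
  ext x
  have hsum : (Matrix.toEuclideanLin (adjMatrix (cayleyGraph S))) (phi π ⟨k, i, j⟩) x =
      ∑ s ∈ S, phi π ⟨k, i, j⟩ (x * s) := by
    change ∑ y, adjMatrix (cayleyGraph S) x y * phi π ⟨k, i, j⟩ y = _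
    -- The out-neighbours of `x` are the products `x * s` with `s ∈ S`.
    rw [← Equiv.sum_comp (Equiv.mulLeft x)]
    simp [adjMatrix, cayleyGraph]
  rw [hsum, WithLp.ofLp_smul, Pi.smul_apply, ← Matrix.trace_sum, smul_eq_mul]
  simp only [phi_apply, map_mul, Submonoid.coe_mul]
  generalize 1 / (d k : ℂ) * _ = c at hscalar ⊢
  rw [← Finset.mul_sum, ← Matrix.sum_apply, ← Matrix.mul_sum, hscalar]
  simp
  ring

end Completeness

/-! ### Frame sums, Fourier inversion and the two operator families. -/

section Frames

/-- Optimality follows by testing any other bound on a single nonzero vector. -/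
lemma isTightFrame_of_sum_eq {H : Type*} [NormedAddCommGroup H] [InnerProductSpace ℂ H]
    [Nontrivial H] {X : Type*} [Fintype X] (v : X → H) {C : ℝ} (hC : 0 < C)
    (h : ∀ f : H, ∑ x, ‖inner ℂ (v x) f‖ ^ 2 = C * ‖f‖ ^ 2) : IsTightFrame v C := by
  obtain ⟨f, hf⟩ := exists_ne (0 : H)
  have hpos : 0 < ‖f‖ ^ 2 := by positivity
  refine ⟨⟨C, C, hC, hC, fun f => (h f).ge, fun f => (h f).le⟩,
    ⟨fun f => (h f).ge, fun a ha => ?_⟩, fun f => (h f).le, fun b hb => ?_⟩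
  · exact le_of_mul_le_mul_right ((ha f).trans (h f).le) hpos
  · exact le_of_mul_le_mul_right ((h f).ge.trans (hb f)) hpos

/-- A family of coefficient vectors with orthogonal columns preserves norms up to a scalar. -/
lemma sum_norm_sq_of_orthogonal {M P : Type*} [Fintype M] [Fintype P] [DecidableEq P]
    (u : M → P → ℂ) (c : ℝ)
    (hu : ∀ p q, ∑ m, star (u m p) * u m q = if p = q then (c : ℂ) else 0) (a : P → ℂ) :
    ∑ m, ‖∑ p, u m p * a p‖ ^ 2 = c * ∑ p, ‖a p‖ ^ 2 := by
  have key : ∑ m, star (∑ p, u m p * a p) * ∑ q, u m q * a q =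
      (c : ℂ) * ∑ p, star (a p) * a p := by
    calc ∑ m, star (∑ p, u m p * a p) * ∑ q, u m q * a q
        = ∑ m, ∑ p, ∑ q, star (a p) * a q * (star (u m p) * u m q) := by
          refine Finset.sum_congr rfl fun m _ => ?_
          rw [star_sum, Finset.sum_mul_sum]
          refine Finset.sum_congr rfl fun p _ => Finset.sum_congr rfl fun q _ => ?_
          rw [star_mul']
          ring
      _ = ∑ p, ∑ q, star (a p) * a q * ∑ m, star (u m p) * u m q := by
          rw [Finset.sum_comm]
          refine Finset.sum_congr rfl fun p _ => ?_
          rw [Finset.sum_comm]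
          exact Finset.sum_congr rfl fun q _ => (Finset.mul_sum _ _ _).symm
      _ = (c : ℂ) * ∑ p, star (a p) * a p := by
          rw [Finset.mul_sum]
          refine Finset.sum_congr rfl fun p _ => ?_
          simp only [hu, mul_ite, mul_zero, Finset.sum_ite_eq, Finset.mem_univ, if_true]
          ring
  have hsq (z : ℂ) : star z * z = ((‖z‖ ^ 2 : ℝ) : ℂ) := by
    rw [Complex.star_def, Complex.conj_mul']
    push_cast
    rfl
  simp only [hsq] at key
  exact_mod_cast key

variable {G : Type*} [Group G] [Fintype G] {D : ℕ} {d : Fin D → ℕ}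
  {π : ∀ k, G →* Matrix.unitaryGroup (Fin (d k)) ℂ}

lemma gft_eq_inner (f : EuclideanSpace ℂ G) (p : BasisIndex d) :
    gft π f p = inner ℂ (phi π p) f := by
  rw [PiLp.inner_apply]
  refine Finset.sum_congr rfl fun x _ => ?_
  rw [RCLike.inner_apply, mul_comm]
  rfl

lemma gft_single [DecidableEq G] (y : G) (p : BasisIndex d) :
    gft π ((Real.sqrt (Fintype.card G : ℝ) : ℂ) • EuclideanSpace.single y 1) p =
      Real.sqrt (Fintype.card G : ℝ) * star (phi π p y) := by
  rw [gft_eq_inner, inner_smul_right, EuclideanSpace.inner_single_right]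
  simp

lemma Phi_mulVec_gft (hπ : IsUnitaryDual π) (f : EuclideanSpace ℂ G) :
    Phi π *ᵥ gft π f = fun x => f x := by
  ext x
  conv_rhs => rw [← (phiBasis hπ).sum_repr' f]
  simp only [WithLp.ofLp_sum, Finset.sum_apply, WithLp.ofLp_smul, Pi.smul_apply, phiBasis_apply,
    smul_eq_mul, ← gft_eq_inner]
  exact Finset.sum_congr rfl fun p _ => mul_comm _ _

lemma conjTranspose_Phi_mul_Phi (hπ : IsUnitaryDual π) : (Phi π)ᴴ * Phi π = 1 := by
  ext p q
  rw [Matrix.one_apply, ← orthonormal_iff_ite.1 (orthonormal_phi hπ) p q, ← gft_eq_inner]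
  rfl

/-- The inner factors `Φᴴ Φ = 1` cancel, so powers act diagonally on Fourier coefficients; exponent
zero is Fourier inversion. -/
lemma shiftMatrix_pow_mulVec [DecidableEq G] (hπ : IsUnitaryDual π) (α : BasisIndex d → ℂ)
    (f : EuclideanSpace ℂ G) (m : ℕ) :
    (shiftMatrix π α ^ m) *ᵥ (fun x => f x) = Phi π *ᵥ fun p => α p ^ m * gft π f p := by
  induction m with
  | zero => simp [Phi_mulVec_gft hπ]
  | succ m ih =>
    rw [pow_succ', ← Matrix.mulVec_mulVec, ih, Matrix.mulVec_mulVec, shiftMatrix,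
      Matrix.mul_assoc, conjTranspose_Phi_mul_Phi hπ, Matrix.mul_one, ← Matrix.mulVec_mulVec]
    congr 1
    ext p
    rw [Matrix.mulVec_diagonal]
    ring

lemma card_basisIndex (hπ : IsUnitaryDual π) :
    Fintype.card (BasisIndex d) = Fintype.card G := by
  rw [← Module.finrank_eq_card_basis (phiBasis hπ).toBasis, finrank_euclideanSpace]

lemma sum_norm_sq_unitary_entries {n : ℕ} (U : Matrix.unitaryGroup (Fin n) ℂ) :
    ∑ i, ∑ j, ‖(U : Matrix (Fin n) (Fin n) ℂ) i j‖ ^ 2 = n := by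
  have h (i : Fin n) : ∑ j, ‖(U : Matrix (Fin n) (Fin n) ℂ) i j‖ ^ 2 = 1 := by
    have h0 : (U : Matrix (Fin n) (Fin n) ℂ) * star (U : Matrix (Fin n) (Fin n) ℂ) = 1 :=
      Unitary.coe_mul_star_self U
    have h1 := congrFun (congrFun h0 i) i
    rw [Matrix.one_apply_eq] at h1
    rw [Matrix.mul_apply] at h1
    simp only [Matrix.star_apply, Complex.star_def, Complex.mul_conj'] at h1
    exact_mod_cast h1
  simp [h]

/-- The right-hand side is free of `x`: the squared entries of the unitary matrix `π k x` sum to `d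
k`, and the normalization supplies another `d k / N`. -/
lemma card_mul_sum_norm_sq (ghat : Fin D → ℂ) (x : G) :
    (Fintype.card G : ℝ) * ∑ p : BasisIndex d, ‖ghat p.1 * phi π p x‖ ^ 2 =
      ∑ k, ‖ghat k‖ ^ 2 * (d k : ℝ) ^ 2 := by
  have hN : (Fintype.card G : ℝ) ≠ 0 := by exact_mod_cast Fintype.card_ne_zero
  rw [Fintype.sum_sigma, Finset.mul_sum]
  refine Finset.sum_congr rfl fun k _ => ?_
  have hterm (q : Fin (d k) × Fin (d k)) : ‖ghat k * phi π ⟨k, q⟩ x‖ ^ 2 =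
      ‖ghat k‖ ^ 2 * ((d k : ℝ) / Fintype.card G) *
        ‖(π k x : Matrix (Fin (d k)) (Fin (d k)) ℂ) q.1 q.2‖ ^ 2 := by
    rw [phi_apply, norm_mul, norm_mul, Complex.norm_real, Real.norm_of_nonneg (Real.sqrt_nonneg _),
      mul_pow, mul_pow, Real.sq_sqrt (by positivity)]
    ring
  simp only [hterm]
  rw [← Finset.mul_sum, Fintype.sum_prod_type, sum_norm_sq_unitary_entries]
  field_simp

lemma sum_norm_sq_mul_dim_sq_pos (hπ : IsUnitaryDual π) {g : EuclideanSpace ℂ G} (hg : g ≠ 0)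
    {ghat : Fin D → ℂ} (hghat : ∀ (k : Fin D) (i j : Fin (d k)), gft π g ⟨k, i, j⟩ = ghat k) :
    0 < ∑ k, ‖ghat k‖ ^ 2 * (d k : ℝ) ^ 2 := by
  have hex : ∃ k, ghat k ≠ 0 := by
    by_contra! h0
    refine hg ?_
    rw [← (phiBasis hπ).sum_repr' g]
    refine Finset.sum_eq_zero fun p _ => ?_
    rw [phiBasis_apply, ← gft_eq_inner, hghat, h0, zero_smul]
  obtain ⟨k, hk⟩ := hex
  refine Finset.sum_pos' (fun k _ => by positivity) ⟨k, Finset.mem_univ k, ?_⟩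
  have : (0 : ℝ) < d k := by exact_mod_cast dim_pos_of_irreducible (hπ.irreducible k)
  positivity

lemma sum_norm_sq_inner_gaborFamily (hπ : IsUnitaryDual π) {M : Type*} [Fintype M]
    (A : M → EuclideanSpace ℂ G → EuclideanSpace ℂ G) (g f : EuclideanSpace ℂ G) :
    ∑ q, ‖inner ℂ (gaborFamily π A g q) f‖ ^ 2 =
      ∑ x, (∑ m, ‖A m g x‖ ^ 2) * ‖f x‖ ^ 2 := by
  have hinner (m : M) (p : BasisIndex d) : inner ℂ (gaborFamily π A g (m, p)) f =
      inner ℂ (phiBasis hπ p) (WithLp.toLp 2 fun x => star (A m g x) * f x) := by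
    rw [phiBasis_apply, PiLp.inner_apply, PiLp.inner_apply]
    refine Finset.sum_congr rfl fun x _ => ?_
    simp only [gaborFamily, RCLike.inner_apply, map_mul, starRingEnd_apply]
    ring
  rw [Fintype.sum_prod_type]
  simp only [hinner, OrthonormalBasis.sum_sq_norm_inner_right, EuclideanSpace.norm_sq_eq]
  rw [Finset.sum_comm]
  refine Finset.sum_congr rfl fun x _ => ?_
  rw [Finset.sum_mul]
  exact Finset.sum_congr rfl fun m _ => by rw [norm_mul, norm_star, mul_pow]

/-- Operators that multiply Fourier coefficients by mutually orthogonal vectors of norm `√N`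
generate tight frames. -/
lemma isTightFrame_gaborFamily (hπ : IsUnitaryDual π) {g : EuclideanSpace ℂ G} (hg : g ≠ 0)
    {ghat : Fin D → ℂ} (hghat : ∀ (k : Fin D) (i j : Fin (d k)), gft π g ⟨k, i, j⟩ = ghat k)
    {M : Type*} [Fintype M] (A : M → EuclideanSpace ℂ G → EuclideanSpace ℂ G)
    (u : M → BasisIndex d → ℂ)
    (hu : ∀ p q, ∑ m, star (u m p) * u m q = if p = q then (Fintype.card G : ℂ) else 0)
    (hA : ∀ m x, A m g x = ∑ p, u m p * (gft π g p * phi π p x)) :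
    IsTightFrame (gaborFamily π A g) (∑ k, ‖ghat k‖ ^ 2 * (d k : ℝ) ^ 2) := by
  refine isTightFrame_of_sum_eq _ (sum_norm_sq_mul_dim_sq_pos hπ hg hghat) fun f => ?_
  rw [sum_norm_sq_inner_gaborFamily hπ, EuclideanSpace.norm_sq_eq, Finset.mul_sum]
  refine Finset.sum_congr rfl fun x _ => ?_
  congr 1
  simp only [hA]
  rw [sum_norm_sq_of_orthogonal u (Fintype.card G) (by simpa only [Complex.ofReal_natCast] using hu),
    ← card_mul_sum_norm_sq (π := π) ghat x]
  congr 1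
  -- This is where constancy of the Fourier coefficients on each block enters.
  exact Finset.sum_congr rfl fun p _ => by rw [← hghat p.1 p.2.1 p.2.2]

lemma translation_apply [DecidableEq G] (f : EuclideanSpace ℂ G) (y x : G) :
    translation π y f x =
      ∑ p, Real.sqrt (Fintype.card G : ℝ) * star (phi π p y) * (gft π f p * phi π p x) := by
  change ∑ p, phi π p x * (gft π f p * gft π _ p) = _
  refine Finset.sum_congr rfl fun p _ => ?_
  rw [gft_single]
  ring

/-- The coefficients carry conjugates of `φ`, so this is orthonormality with `p` and `q` exchanged.
-/
lemma sum_star_translation_coefficients (hπ : IsUnitaryDual π) (p q : BasisIndex d) :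
    ∑ y : G, star (Real.sqrt (Fintype.card G : ℝ) * star (phi π p y)) *
        (Real.sqrt (Fintype.card G : ℝ) * star (phi π q y)) =
      if p = q then (Fintype.card G : ℂ) else 0 := by
  have h := orthonormal_iff_ite.1 (orthonormal_phi hπ) q p
  rw [PiLp.inner_apply] at h
  have hs : (Real.sqrt (Fintype.card G : ℝ) : ℂ) * Real.sqrt (Fintype.card G : ℝ) =
      Fintype.card G := by
    rw [← Complex.ofReal_mul, Real.mul_self_sqrt (by positivity), Complex.ofReal_natCast]
  calc _ = (Fintype.card G : ℂ) * ∑ y : G, inner ℂ (phi π q y) (phi π p y) := by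
        rw [Finset.mul_sum]
        refine Finset.sum_congr rfl fun y _ => ?_
        rw [← hs, RCLike.inner_apply, star_mul', star_star, Complex.star_def, Complex.conj_ofReal,
          starRingEnd_apply, Complex.star_def]
        ring
    _ = _ := by
        rw [h]
        simp [eq_comm]

/-- The common phase `c` cancels, leaving an `N`-th root of unity when `N ≠ 0`. -/
lemma star_phase_mul_phase (N : ℕ) (c : ℝ)
    (e : BasisIndex d ≃ Fin (Fintype.card (BasisIndex d))) (p q : BasisIndex d) :
    star (phase N c e p) * phase N c e q =
      Complex.exp (2 * Real.pi * Complex.I * ((((e p : ℕ) : ℂ) - (e q : ℕ)) / N)) := by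
  rw [phase, phase, Complex.star_def, ← Complex.exp_conj, ← Complex.exp_add, map_mul,
    Complex.conj_I, Complex.conj_ofReal]
  congr 1
  push_cast
  ring

lemma sum_star_phase_pow (hπ : IsUnitaryDual π) (c : ℝ)
    (e : BasisIndex d ≃ Fin (Fintype.card (BasisIndex d))) (p q : BasisIndex d) :
    ∑ m : Fin (Fintype.card G), star (phase (Fintype.card G) c e p ^ (m : ℕ)) *
        phase (Fintype.card G) c e q ^ (m : ℕ) =
      if p = q then (Fintype.card G : ℂ) else 0 := by
  have hN : (Fintype.card G : ℂ) ≠ 0 := by exact_mod_cast Fintype.card_ne_zero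
  simp only [star_pow, ← mul_pow, star_phase_mul_phase]
  split_ifs with hpq
  · subst hpq
    simp
  · rw [Fin.sum_univ_eq_sum_range fun m => Complex.exp _ ^ m, geom_sum_eq]
    · rw [← Complex.exp_nat_mul, div_eq_zero_iff, sub_eq_zero]
      left
      refine Complex.exp_eq_one_iff.2 ⟨(e p : ℕ) - (e q : ℕ), ?_⟩
      push_cast
      field_simp
    · intro h1
      obtain ⟨n, hn⟩ := Complex.exp_eq_one_iff.1 h1
      have h2 : (((e p : ℕ) : ℂ) - (e q : ℕ)) / (Fintype.card G : ℂ) = n :=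
        mul_left_cancel₀ Complex.two_pi_I_ne_zero (hn.trans (mul_comm _ _))
      rw [div_eq_iff hN] at h2
      have h3 : ((e p : ℕ) : ℤ) - (e q : ℕ) = n * (Fintype.card G : ℕ) := by exact_mod_cast h2
      -- There are exactly `N` basis indices, so two positions differ by less than `N`; a difference
      -- divisible by `N` must vanish.
      have hp : (e p : ℕ) < Fintype.card G := (e p).2.trans_eq (card_basisIndex hπ)
      have hq : (e q : ℕ) < Fintype.card G := (e q).2.trans_eq (card_basisIndex hπ)
      have h4 : ((e p : ℕ) : ℤ) - (e q : ℕ) = 0 :=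
        Int.eq_zero_of_abs_lt_dvd (m := (Fintype.card G : ℕ)) ⟨n, by rw [h3, mul_comm]⟩
          (by rw [abs_lt]; omega)
      exact hpq (e.injective (Fin.ext (by omega)))

lemma repeatedShift_apply [DecidableEq G] (hπ : IsUnitaryDual π) (α : BasisIndex d → ℂ)
    (f : EuclideanSpace ℂ G) (m : Fin (Fintype.card G)) (x : G) :
    repeatedShift π α m f x = ∑ p, α p ^ (m : ℕ) * (gft π f p * phi π p x) := by
  change ((shiftMatrix π α ^ (m : ℕ)) *ᵥ fun x => f x) x = _
  rw [shiftMatrix_pow_mulVec hπ]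
  refine Finset.sum_congr rfl fun p _ => ?_
  change phi π p x * _ = _
  ring

end Frames

end CayleyGabor

open CayleyGabor
theorem mainTheorem10 {G : Type*} [Group G] [Fintype G] [DecidableEq G]
    (S : Finset G) (hS : ∀ x : G, ∀ s ∈ S, x * s * x⁻¹ ∈ S)
    {D : ℕ} {d : Fin D → ℕ} (π : ∀ k, G →* Matrix.unitaryGroup (Fin (d k)) ℂ)
    (hπ : IsUnitaryDual π)
    (g : EuclideanSpace ℂ G) (hg : g ≠ 0) (ghat : Fin D → ℂ)
    (hghat : ∀ (k : Fin D) (i j : Fin (d k)), gft π g ⟨k, i, j⟩ = ghat k) :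
    -- the `φ` form an orthonormal basis of eigenvectors of the adjacency matrix of `Cay(G; S)`
    (Orthonormal ℂ (phi π) ∧ Submodule.span ℂ (Set.range (phi π)) = ⊤ ∧
      ∀ p : BasisIndex d,
        (Matrix.toEuclideanLin (adjMatrix (cayleyGraph S))) (phi π p) =
          ((1 / (d p.1 : ℂ)) *
            ∑ s ∈ S, Matrix.trace (π p.1 s : Matrix (Fin (d p.1)) (Fin (d p.1)) ℂ)) •
            phi π p) ∧
    -- the translations by convolution
    IsTightFrame (gaborFamily π (translation π) g)
      (∑ k, ‖ghat k‖ ^ 2 * (d k : ℝ) ^ 2) ∧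
    -- the repeated shifts, for every phase shift and every enumeration of the basis
    (∀ c ∈ Set.Ico (0 : ℝ) (2 * Real.pi),
      ∀ e : BasisIndex d ≃ Fin (Fintype.card (BasisIndex d)),
        IsTightFrame (gaborFamily π (repeatedShift π (phase (Fintype.card G) c e)) g)
          (∑ k, ‖ghat k‖ ^ 2 * (d k : ℝ) ^ 2)) := by
  exact ⟨⟨orthonormal_phi hπ, span_phi_eq_top hπ, adjMatrix_cayleyGraph_phi hπ S hS⟩,
    isTightFrame_gaborFamily hπ hg hghat _ _ (sum_star_translation_coefficients hπ)
      fun y x => translation_apply g y x,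
    fun c _ e => isTightFrame_gaborFamily hπ hg hghat _ _ (sum_star_phase_pow hπ c e)
      fun m x => repeatedShift_apply hπ _ g m x⟩
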